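/- There is a function $C:\mathbb{N}\to\mathbb{R}$, $m\mapsto C_m$, such that the following holds. Let $r\ge 2$, $d,n\ge 0$ be integers, let $T_1,\dots,T_n\in(\mathbb{R}^d)^{\otimes (r-1)}$ be deterministic tensors, and let $\xi_1,\dots,\xi_n$ be independent mean-zero real random variables that are subgaussian, i.e. $\mathbb{E}\exp(\lambda\xi_k)\le\exp(\lambda^2/2)$ for all $\lambda\in\mathbb{R}$ (for instance, independent standard Gaussians). Put $T=\sum_{k=1}^n\xi_kT_k$, and let $A\in(\mathbb{R}^d)^{\otimes(r-1)}\otimes\mathbb{R}^n$ be the order-$r$ tensor obtained by stacking the $T_k$ along a new last index, $A_{i_1,\dots,i_{r-1},k}=(T_k)_{i_1,\dots,i_{r-1}}$. Let $S(s)$ denote the set of partitions of $\{1,\dots,s\}$ into non-empty blocks. For an order-$s$ tensor $B$ and a partition $\mathcal{Q}=\{I_1,\dots,I_m\}\in S(s)$, let $B^{\mathcal{Q}}$ be $B$ viewed as an order-$m$ tensor whose $j$th index is the tuple $(i_t)_{t\in I_j}$. For a tensor $B\in\mathbb{R}^{D_1}\otimes\dots\otimes\mathbb{R}^{D_m}$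 let $\|B\|_{2\text{-inj}}=\sup B(x_1,\dots,x_m)$, the supremum being over all $x_j\in\mathbb{R}^{D_j}$ with $\|x_j\|_2\le 1$. Then for every partition $\mathcal{P}\in S(r-1)$ and every real $p\ge 2$, the $p$th moment of $\|T^{\mathcal{P}}\|_{2\text{-inj}}$ is finite and \[ \left(\mathbb{E}\,\|T^{\mathcal{P}}\|_{2\text{-inj}}^p\right)^{1/p}\le C_{|\mathcal{P}|}\sum_{\mathcal{Q}\in S(r)}p^{\frac{|\mathcal{Q}|-|\mathcal{P}|}{2}}\,\|A^{\mathcal{Q}}\|_{2\text{-inj}} . \] -/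

import Mathlib

open MeasureTheory ProbabilityTheory

noncomputable section

/-- Real tensors with one mode for every `i : ι`, the `i`-th mode being indexed by `κ i`:
the space `⨂ i, ℝ^(κ i)`, a tensor being given by its array of entries. -/
abbrev Tensor {ι : Type} (κ : ι → Type) : Type := (∀ i, κ i) → ℝ

namespace Tensor

/-- The multilinear form `A(x) = ∑_j A_j ∏_i (x_i)_{j_i}` of a tensor. -/
def eval {ι : Type} [Fintype ι] [DecidableEq ι] {κ : ι → Type} [∀ i, Fintype (κ i)]
    (A : Tensor κ) (x : ∀ i, EuclideanSpace ℝ (κ i)) : ℝ :=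
  ∑ j : (∀ i, κ i), A j * ∏ i, x i (j i)

/-- The `ℓ₂` injective norm: the supremum of `A(x)` over vectors `x_i` in the closed Euclidean
unit balls. -/
def injNorm {ι : Type} [Fintype ι] [DecidableEq ι] {κ : ι → Type} [∀ i, Fintype (κ i)]
    (A : Tensor κ) : ℝ :=
  sSup {a : ℝ | ∃ x : ∀ i, EuclideanSpace ℝ (κ i), (∀ i, ‖x i‖ ≤ 1) ∧ a = A.eval x}

/-- For a partition `P` of the set of modes, the tensor `A^P`: the same entries, with one mode for
every block `I` of `P`, that mode being indexed by the tuples `(i_t)_{t ∈ I}`. -/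
def regroup {ι : Type} [Fintype ι] [DecidableEq ι] {κ : ι → Type}
    (P : Finpartition (Finset.univ : Finset ι)) (A : Tensor κ) :
    Tensor (fun I : P.parts => ∀ t : I.1, κ t) :=
  fun j => A fun t =>
    j ⟨P.part t, P.part_mem.2 (Finset.mem_univ t)⟩ ⟨t, P.mem_part (Finset.mem_univ t)⟩

/-- The dimensions `(d, …, d, n)` of the modes of a tensor in `(ℝ^d)^{⊗N} ⊗ ℝ^n`. -/
def stackDim (N d n : ℕ) : Fin (N + 1) → ℕ :=
  Fin.snoc (α := fun _ => ℕ) (fun _ : Fin N => d) n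

theorem stackDim_castSucc (N d n : ℕ) (t : Fin N) : stackDim N d n t.castSucc = d :=
  Fin.snoc_castSucc (α := fun _ => ℕ) n (fun _ : Fin N => d) t

theorem stackDim_last (N d n : ℕ) : stackDim N d n (Fin.last N) = n :=
  Fin.snoc_last (α := fun _ => ℕ) n (fun _ : Fin N => d)

/-- Stacking `T_1, …, T_n ∈ (ℝ^d)^{⊗N}` along a new last index: the tensor
`A ∈ (ℝ^d)^{⊗N} ⊗ ℝ^n` with entries `A_{i_1, …, i_N, k} = (T_k)_{i_1, …, i_N}`. -/
def stack {N d n : ℕ} (T : Fin n → Tensor (fun _ : Fin N => Fin d)) :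
    Tensor (fun t : Fin (N + 1) => Fin (stackDim N d n t)) :=
  fun j => T (Fin.cast (stackDim_last N d n) (j (Fin.last N)))
    fun t => Fin.cast (stackDim_castSucc N d n t) (j t.castSucc)

end Tensor

end

/-! The supremum over unit vectors is handled by Gaussian smoothing (a PAC-Bayes argument), without
nets or chaining. Put m = |P|, B_k = T_k^P and B = ∑ ξ_k B_k. A maximizer x of B depends on ξ, but
multilinearity gives B(x) = E B(X) for X Gaussian with independent coordinates, mean x and variance
v. The Gibbs variational inequality (`ofReal_exp_integral_sub_le_lintegral`) bounds E f(X), up to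
the relative entropy ∑ ‖x_i‖²/(2v) ≤ m/(2v), by log ∫ e^f under the centred Gaussian, a prior that
does not depend on ξ. For f = ∑_k (l ξ_k B_k − l² B_k²/2), subgaussianity makes the ξ-mean of e^f at
most 1 at each fixed point, so Tonelli controls the exponential moment of the norm
(`lintegral_exp_injNorm_le`).

The price is ∑_k E B_k(X)². By `integral_form_sq` it splits over the sets J of blocks evaluated at
x, every other block contributing a factor v and a Hilbert–Schmidt contraction. By
`sum_partialSq_regroup_le` the J-term is at most v^(m−|J|) ‖A^Q‖², where Q keeps the blocks in J and
merges all other modes with the stacking index; thus |Q| = |J| + 1. The choice v = 1/p produces the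
stated powers of p. -/

/-! ### Change of measure and the variational inequality for Gaussian translates -/

theorem pi_withDensity {ι : Type*} [Fintype ι] {E : ι → Type*} [∀ i, MeasurableSpace (E i)]
    (ν : ∀ i, Measure (E i)) [∀ i, IsProbabilityMeasure (ν i)] (f : ∀ i, E i → ENNReal)
    (hf : ∀ i, Measurable (f i)) [∀ i, SigmaFinite ((ν i).withDensity (f i))] :
    Measure.pi (fun i => (ν i).withDensity (f i)) =
      (Measure.pi ν).withDensity fun x => ∏ i, f i (x i) := by
  classical
  refine (Measure.pi_eq fun s hs => ?_)
  rw [withDensity_apply _ (MeasurableSet.univ_pi hs), ← lintegral_indicator (MeasurableSet.univ_pi hs)]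
  have h1 : ∀ x : (∀ i, E i), (Set.univ.pi s).indicator (fun x => ∏ i, f i (x i)) x =
      ∏ i, (s i).indicator (f i) (x i) := by
    intro x
    by_cases hx : x ∈ Set.univ.pi s
    · rw [Set.indicator_of_mem hx]
      exact Finset.prod_congr rfl fun i _ => (Set.indicator_of_mem (hx i (Set.mem_univ i)) _).symm
    · rw [Set.indicator_of_notMem hx]
      simp only [Set.mem_pi, Set.mem_univ, true_implies, not_forall] at hx
      obtain ⟨i, hi⟩ := hx
      exact (Finset.prod_eq_zero (Finset.mem_univ i) (Set.indicator_of_notMem hi _)).symm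
  simp_rw [h1]
  have hm : ∀ i, Measurable ((s i).indicator (f i)) := fun i => (hf i).indicator (hs i)
  have hI : iIndepFun (fun i (x : ∀ i, E i) => (s i).indicator (f i) (x i)) (Measure.pi ν) :=
    iIndepFun_pi fun i => (hm i).aemeasurable
  rw [lintegral_prod_eq_prod_lintegral_of_indepFun Finset.univ _ hI
    fun i => (hm i).comp (measurable_pi_apply i)]
  refine Finset.prod_congr rfl fun i _ => ?_
  rw [(measurePreserving_eval ν i).lintegral_comp (hm i), lintegral_indicator (hs i),
    withDensity_apply _ (hs i)]

/-- Jensen's inequality. With the right side in `ENNReal`, no integrability of the exponential is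
needed: if it fails, that side is infinite. -/
theorem ofReal_exp_integral_le {α : Type*} [MeasurableSpace α] (ν : Measure α)
    [IsProbabilityMeasure ν] {g : α → ℝ} (hg : Integrable g ν) :
    ENNReal.ofReal (Real.exp (∫ a, g a ∂ν)) ≤ ∫⁻ a, ENNReal.ofReal (Real.exp (g a)) ∂ν := by
  by_cases h : Integrable (fun a => Real.exp (g a)) ν
  · rw [← ofReal_integral_eq_lintegral_ofReal h (ae_of_all _ fun a => (Real.exp_pos _).le)]
    exact ENNReal.ofReal_le_ofReal (convexOn_exp.map_integral_le Real.continuous_exp.continuousOn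
      isClosed_univ (ae_of_all _ fun _ => Set.mem_univ _) hg h)
  · have : ∫⁻ a, ENNReal.ofReal (Real.exp (g a)) ∂ν = ⊤ := by
      by_contra hne
      refine h ((lintegral_ofReal_ne_top_iff_integrable
        (Real.continuous_exp.comp_aestronglyMeasurable hg.1)
        (ae_of_all _ fun a => (Real.exp_pos _).le)).1 hne)
    rw [this]; exact le_top

/-- The exponent is (y − a)²/(2v) − y²/(2v). The centred law is expressed through the translate so
that Jensen can be applied under the translate. -/
theorem gaussianReal_zero_eq_withDensity (a : ℝ) {v : NNReal} (hv : v ≠ 0) :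
    gaussianReal 0 v = (gaussianReal a v).withDensity
      fun y => ENNReal.ofReal (Real.exp ((a ^ 2 - 2 * a * y) / (2 * v))) := by
  rw [gaussianReal_of_var_ne_zero _ hv, gaussianReal_of_var_ne_zero _ hv,
    ← withDensity_mul _ (measurable_gaussianPDF _ _) (by fun_prop)]
  congr 1
  ext y
  have hv' : (v : ℝ) ≠ 0 := by exact_mod_cast hv
  rw [Pi.mul_apply, gaussianPDF_def, gaussianPDF_def,
    ← ENNReal.ofReal_mul (gaussianPDFReal_nonneg _ _ _), gaussianPDFReal_def, gaussianPDFReal_def]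
  dsimp only
  rw [mul_assoc _ (Real.exp _) (Real.exp _), ← Real.exp_add]
  congr 3
  field_simp
  ring

section

variable {ι : Type} [Fintype ι] {κ : ι → Type} [∀ i, Fintype (κ i)]

/-- The law of a family of independent Gaussian vectors with means `x i` and covariances `v • 1`. -/
noncomputable def gaussianProduct (v : NNReal) (x : ∀ i, κ i → ℝ) : Measure (∀ i, κ i → ℝ) :=
  Measure.pi fun i => Measure.pi fun j => gaussianReal (x i j) v

instance (v : NNReal) (x : ∀ i, κ i → ℝ) : IsProbabilityMeasure (gaussianProduct v x) := by
  unfold gaussianProduct; infer_instance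

theorem gaussianProduct_zero_eq_withDensity {v : NNReal} (hv : v ≠ 0) (x : ∀ i, κ i → ℝ) :
    gaussianProduct v (0 : ∀ i, κ i → ℝ) = (gaussianProduct v x).withDensity fun X =>
      ENNReal.ofReal (Real.exp (∑ i, ∑ j, (x i j ^ 2 - 2 * x i j * X i j) / (2 * v))) := by
  have h1 : ∀ i, Measure.pi (fun _ : κ i => gaussianReal 0 v) =
      (Measure.pi fun j => gaussianReal (x i j) v).withDensity fun y =>
        ∏ j, ENNReal.ofReal (Real.exp ((x i j ^ 2 - 2 * x i j * y j) / (2 * v))) := by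
    intro i
    have : ∀ j, IsProbabilityMeasure ((gaussianReal (x i j) v).withDensity
        fun y => ENNReal.ofReal (Real.exp ((x i j ^ 2 - 2 * x i j * y) / (2 * v)))) := fun j => by
      rw [← gaussianReal_zero_eq_withDensity _ hv]; infer_instance
    rw [← pi_withDensity (fun j => gaussianReal (x i j) v)
      (fun j y => ENNReal.ofReal (Real.exp ((x i j ^ 2 - 2 * x i j * y) / (2 * v))))
      fun j => by fun_prop]
    congr 1
    ext1 j
    exact gaussianReal_zero_eq_withDensity _ hv
  have : ∀ i, IsProbabilityMeasure ((Measure.pi fun j => gaussianReal (x i j) v).withDensity fun y =>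
        ∏ j, ENNReal.ofReal (Real.exp ((x i j ^ 2 - 2 * x i j * y j) / (2 * v)))) := fun i => by
    rw [← h1]; infer_instance
  unfold gaussianProduct
  simp only [Pi.zero_apply]
  simp_rw [h1]
  rw [pi_withDensity _ _ fun i => by fun_prop]
  congr 1
  ext X
  rw [Real.exp_sum, ENNReal.ofReal_prod_of_nonneg fun _ _ => (Real.exp_pos _).le]
  refine Finset.prod_congr rfl fun i _ => ?_
  rw [Real.exp_sum, ENNReal.ofReal_prod_of_nonneg fun _ _ => (Real.exp_pos _).le]

theorem measurePreserving_gaussianProduct (v : NNReal) (x : ∀ i, κ i → ℝ) (i : ι) (j : κ i) :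
    MeasurePreserving (fun X : ∀ i, κ i → ℝ => X i j) (gaussianProduct v x)
      (gaussianReal (x i j) v) :=
  (measurePreserving_eval (fun j => gaussianReal (x i j) v) j).comp
    (measurePreserving_eval (fun i => Measure.pi fun j => gaussianReal (x i j) v) i)

theorem integrable_gaussianProduct_coord (v : NNReal) (x : ∀ i, κ i → ℝ) (i : ι) (j : κ i) :
    Integrable (fun X : ∀ i, κ i → ℝ => X i j) (gaussianProduct v x) :=
  ((measurePreserving_gaussianProduct v x i j).integrable_comp (g := id) (by fun_prop)).2
    ((memLp_id_gaussianReal 1).integrable (by simp))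

theorem integral_gaussianProduct_coord (v : NNReal) (x : ∀ i, κ i → ℝ) (i : ι) (j : κ i) :
    ∫ X, X i j ∂gaussianProduct v x = x i j := by
  have h := measurePreserving_gaussianProduct v x i j
  have := integral_map h.measurable.aemeasurable (f := id)
    (by rw [h.map_eq]; fun_prop)
  rw [h.map_eq] at this
  exact this.symm.trans integral_id_gaussianReal

/-- The variational lower bound for a Gaussian prior and its translates. -/
theorem ofReal_exp_integral_sub_le_lintegral {v : NNReal} (hv : v ≠ 0) (x : ∀ i, κ i → ℝ)
    {f : (∀ i, κ i → ℝ) → ℝ} (hf : Integrable f (gaussianProduct v x)) (hm : Measurable f) :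
    ENNReal.ofReal (Real.exp (∫ X, f X ∂gaussianProduct v x - (∑ i, ∑ j, x i j ^ 2) / (2 * v))) ≤
      ∫⁻ X, ENNReal.ofReal (Real.exp (f X)) ∂gaussianProduct v (0 : ∀ i, κ i → ℝ) := by
  rw [gaussianProduct_zero_eq_withDensity hv x,
    lintegral_withDensity_eq_lintegral_mul _ (by fun_prop) (by fun_prop)]
  have hc := integrable_gaussianProduct_coord v x
  have hcoord : ∀ i j, Integrable (fun X : ∀ i, κ i → ℝ => (x i j ^ 2 - 2 * x i j * X i j) / (2 * v))
      (gaussianProduct v x) := fun i j =>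
    ((integrable_const _).sub ((hc i j).const_mul _)).div_const _
  have hint : Integrable (fun X : ∀ i, κ i → ℝ =>
      ∑ i, ∑ j, (x i j ^ 2 - 2 * x i j * X i j) / (2 * v)) (gaussianProduct v x) :=
    integrable_finsetSum _ fun i _ => integrable_finsetSum _ fun j _ => hcoord i j
  -- Jensen is applied to f plus the log-density, whose mean under the translate is minus the
  -- relative entropy.
  refine le_trans (le_of_eq ?_) ((ofReal_exp_integral_le _ (hint.add hf)).trans_eq ?_)
  · congr 2
    rw [integral_add' hint hf, integral_finsetSum _ fun i _ => integrable_finsetSum _ fun j _ =>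
      hcoord i j]
    have : ∀ i, ∫ X, ∑ j, (x i j ^ 2 - 2 * x i j * X i j) / (2 * v) ∂gaussianProduct v x
        = - ∑ j, x i j ^ 2 / (2 * v) := by
      intro i
      rw [integral_finsetSum _ fun j _ => hcoord i j, ← Finset.sum_neg_distrib]
      refine Finset.sum_congr rfl fun j _ => ?_
      rw [integral_div, integral_sub (integrable_const _) ((hc i j).const_mul _), integral_const_mul,
        integral_gaussianProduct_coord]
      simp
      ring
    simp_rw [this]
    rw [Finset.sum_neg_distrib, Finset.sum_div]
    simp_rw [Finset.sum_div]
    ring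
  · refine lintegral_congr fun X => ?_
    simp only [Pi.add_apply, Pi.mul_apply]
    rw [Real.exp_add, ENNReal.ofReal_mul (Real.exp_pos _).le]

end

/-! ### First and second moments of Gaussian coordinates -/

section

variable {κ : Type} [Fintype κ]

theorem memLp_pi_gaussianReal (v : NNReal) (x : κ → ℝ) (j : κ) :
    MemLp (fun X : κ → ℝ => X j) 2 (Measure.pi fun j => gaussianReal (x j) v) :=
  (memLp_id_gaussianReal 2).comp_measurePreserving
    (measurePreserving_eval (fun j => gaussianReal (x j) v) j)

theorem integral_pi_gaussianReal (v : NNReal) (x : κ → ℝ) (j : κ) :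
    ∫ X, X j ∂(Measure.pi fun j => gaussianReal (x j) v) = x j := by
  have h := measurePreserving_eval (fun j => gaussianReal (x j) v) j
  have := integral_map h.measurable.aemeasurable (f := id) (by rw [h.map_eq]; fun_prop)
  rw [h.map_eq] at this
  exact this.symm.trans integral_id_gaussianReal

theorem integral_mul_pi_gaussianReal [DecidableEq κ] (v : NNReal) (x : κ → ℝ) (j j' : κ) :
    ∫ X, X j * X j' ∂(Measure.pi fun j => gaussianReal (x j) v) =
      x j * x j' + if j = j' then (v : ℝ) else 0 := by
  have hc : cov[fun X : κ → ℝ => X j, fun X => X j'; Measure.pi fun j => gaussianReal (x j) v] =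
      if j = j' then (v : ℝ) else 0 := by
    split_ifs with h
    · subst h
      rw [covariance_self (memLp_pi_gaussianReal v x j).1.aemeasurable]
      have h := measurePreserving_eval (fun j => gaussianReal (x j) v) j
      have := variance_map (μ := Measure.pi fun j => gaussianReal (x j) v) (X := id)
        (Y := Function.eval j) (by fun_prop) h.measurable.aemeasurable
      rw [h.map_eq, variance_id_gaussianReal] at this
      exact this.symm
    · refine IndepFun.covariance_eq_zero ?_ (memLp_pi_gaussianReal v x j)
        (memLp_pi_gaussianReal v x j')
      exact (iIndepFun_pi (X := fun _ => id) fun _ => aemeasurable_id).indepFun h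
  rw [covariance_eq_sub (memLp_pi_gaussianReal v x j) (memLp_pi_gaussianReal v x j'),
    integral_pi_gaussianReal, integral_pi_gaussianReal] at hc
  have : (fun X : κ → ℝ => X j) * (fun X => X j') = fun X => X j * X j' := rfl
  rw [this] at hc
  linarith

end

/-! ### The injective norm, and Gaussian moments of multilinear forms -/

namespace Tensor

section

set_option linter.unusedSectionVars false

variable {ι : Type} [Fintype ι] [DecidableEq ι] {κ : ι → Type} [∀ i, Fintype (κ i)]

theorem continuous_eval :
    Continuous fun q : Tensor κ × (∀ i, EuclideanSpace ℝ (κ i)) => q.1.eval q.2 := by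
  unfold eval
  fun_prop

theorem setOf_eval_eq_image (A : Tensor κ) :
    {a : ℝ | ∃ x : ∀ i, EuclideanSpace ℝ (κ i), (∀ i, ‖x i‖ ≤ 1) ∧ a = A.eval x} =
      A.eval '' Set.univ.pi fun _ => Metric.closedBall 0 1 := by
  ext a
  simp [Set.mem_image, eq_comm]

theorem isCompact_pi_closedBall :
    IsCompact (Set.univ.pi fun i => Metric.closedBall (0 : EuclideanSpace ℝ (κ i)) 1) :=
  isCompact_univ_pi fun _ => isCompact_closedBall _ _

/-- A jointly continuous function is maximized over a fixed compact set. This yields the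
measurability of the norm of the random tensor. -/
theorem continuous_injNorm : Continuous (injNorm : Tensor κ → ℝ) := by
  unfold injNorm
  simp_rw [setOf_eval_eq_image]
  exact isCompact_pi_closedBall.continuous_sSup continuous_eval

theorem exists_injNorm_eq_eval (A : Tensor κ) :
    ∃ x : ∀ i, EuclideanSpace ℝ (κ i), (∀ i, ‖x i‖ ≤ 1) ∧ A.injNorm = A.eval x := by
  obtain ⟨x, hx, h⟩ := isCompact_pi_closedBall.exists_sSup_image_eq
    (s := Set.univ.pi fun i => Metric.closedBall (0 : EuclideanSpace ℝ (κ i)) 1) (f := A.eval)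
    ⟨0, by simp⟩ (continuous_eval.comp (by fun_prop : Continuous fun x => (A, x))).continuousOn
  refine ⟨x, by simpa using hx, ?_⟩
  rw [injNorm, setOf_eval_eq_image, h]

theorem eval_le_injNorm (A : Tensor κ) (x : ∀ i, EuclideanSpace ℝ (κ i)) (hx : ∀ i, ‖x i‖ ≤ 1) :
    A.eval x ≤ A.injNorm := by
  refine le_csSup ?_ ⟨x, hx, rfl⟩
  rw [setOf_eval_eq_image]
  exact (isCompact_pi_closedBall.image
    (continuous_eval.comp (by fun_prop : Continuous fun x => (A, x)))).bddAbove

theorem injNorm_nonneg [Nonempty ι] (A : Tensor κ) : 0 ≤ A.injNorm := by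
  refine le_trans (le_of_eq ?_) (eval_le_injNorm A 0 (by simp))
  simp [eval, Finset.prod_const]

/-- The multilinear form of a tensor, on tuples of vectors that carry no norm. -/
def form (A : Tensor κ) (X : ∀ i, κ i → ℝ) : ℝ := ∑ j, A j * ∏ i, X i (j i)

theorem form_ofLp (A : Tensor κ) (x : ∀ i, EuclideanSpace ℝ (κ i)) :
    (A.form fun i j => x i j) = A.eval x := rfl

theorem form_sum_smul {K : Type*} [Fintype K] (c : K → ℝ) (B : K → Tensor κ) (X : ∀ i, κ i → ℝ) :
    (∑ k, c k • B k).form X = ∑ k, c k * (B k).form X := by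
  simp only [form, Finset.sum_apply, Pi.smul_apply, smul_eq_mul, Finset.mul_sum, Finset.sum_mul]
  rw [Finset.sum_comm]
  simp [mul_assoc]

theorem measurable_form (A : Tensor κ) : Measurable A.form := by
  unfold form; fun_prop

variable (v : NNReal) (x : ∀ i, κ i → ℝ)

theorem integrable_form_term (A : Tensor κ) (j : ∀ i, κ i) :
    Integrable (fun X : ∀ i, κ i → ℝ => A j * ∏ i, X i (j i)) (gaussianProduct v x) :=
  (Integrable.fintype_prod_dep fun i =>
    (memLp_pi_gaussianReal v (x i) (j i)).integrable one_le_two).const_mul _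

theorem integrable_form (A : Tensor κ) : Integrable A.form (gaussianProduct v x) :=
  integrable_finsetSum _ fun j _ => integrable_form_term v x A j

/-- Each monomial takes one coordinate from each mode, and the modes are independent. -/
theorem integral_form (A : Tensor κ) : ∫ X, A.form X ∂gaussianProduct v x = A.form x := by
  unfold form
  rw [integral_finsetSum _ fun j _ => integrable_form_term v x A j]
  refine Finset.sum_congr rfl fun j _ => ?_
  rw [integral_const_mul, gaussianProduct]
  congr 1
  rw [integral_fintype_prod_eq_prod (f := fun i (X : κ i → ℝ) => X (j i))]
  simp_rw [integral_pi_gaussianReal]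

variable [∀ i, DecidableEq (κ i)]

/-- The squared Hilbert–Schmidt norm of the tensor obtained from `A` by evaluating the modes in `J`
at the vectors `x i`. -/
def partialSq (J : Finset ι) (A : Tensor κ) (x : ∀ i, κ i → ℝ) : ℝ :=
  ∑ j, ∑ j', A j * A j' *
    ∏ i, if i ∈ J then x i (j i) * x i (j' i) else if j i = j' i then 1 else 0

theorem form_sq_eq (A : Tensor κ) (X : ∀ i, κ i → ℝ) :
    A.form X ^ 2 = ∑ j, ∑ j', A j * A j' * ∏ i, (X i (j i) * X i (j' i)) := by
  simp_rw [form, sq, Finset.sum_mul_sum, Finset.prod_mul_distrib]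
  exact Finset.sum_congr rfl fun _ _ => Finset.sum_congr rfl fun _ _ => by ring

theorem integrable_form_sq_term (a : ℝ) (j j' : ∀ i, κ i) :
    Integrable (fun X : ∀ i, κ i → ℝ => a * ∏ i, (X i (j i) * X i (j' i)))
      (gaussianProduct v x) :=
  (Integrable.fintype_prod_dep (f := fun i (X : κ i → ℝ) => X (j i) * X (j' i)) fun i =>
    (memLp_pi_gaussianReal v (x i) (j i)).integrable_mul
      (memLp_pi_gaussianReal v (x i) (j' i))).const_mul _

theorem integrable_form_sq (A : Tensor κ) :
    Integrable (fun X => A.form X ^ 2) (gaussianProduct v x) := by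
  simp_rw [form_sq_eq]
  exact integrable_finsetSum _ fun j _ => integrable_finsetSum _ fun j' _ =>
    integrable_form_sq_term v x _ j j'

/-- Each mode contributes E X_a X_b = x_a x_b + v δ_ab. Expanding the product over modes, J is the
set of modes where the first summand is chosen. -/
theorem integral_form_sq (A : Tensor κ) :
    ∫ X, A.form X ^ 2 ∂gaussianProduct v x = ∑ J, (v : ℝ) ^ (Jᶜ).card * partialSq J A x := by
  simp_rw [form_sq_eq]
  rw [integral_finsetSum _ fun j _ => integrable_finsetSum _ fun j' _ =>
    integrable_form_sq_term v x _ j j']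
  simp_rw [partialSq, Finset.mul_sum]
  rw [Finset.sum_comm]
  refine Finset.sum_congr rfl fun j _ => ?_
  rw [integral_finsetSum _ fun j' _ => integrable_form_sq_term v x _ j j', Finset.sum_comm]
  refine Finset.sum_congr rfl fun j' _ => ?_
  rw [integral_const_mul, gaussianProduct,
    integral_fintype_prod_eq_prod (f := fun i (X : κ i → ℝ) => X (j i) * X (j' i))]
  simp_rw [integral_mul_pi_gaussianReal]
  rw [Finset.prod_add, Finset.powerset_univ, Finset.mul_sum]
  refine Finset.sum_congr rfl fun J _ => ?_
  rw [← Finset.prod_mul_prod_compl J, Finset.prod_congr rfl fun i (hi : i ∈ J) => if_pos hi,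
    Finset.prod_congr rfl fun i (hi : i ∈ Jᶜ) => if_neg (Finset.mem_compl.1 hi),
    ← Finset.compl_eq_univ_sdiff]
  have : ∏ i ∈ Jᶜ, (if j i = j' i then (v : ℝ) else 0) =
      (v : ℝ) ^ (Jᶜ).card * ∏ i ∈ Jᶜ, if j i = j' i then (1 : ℝ) else 0 := by
    rw [← Finset.prod_const, ← Finset.prod_mul_distrib]
    simp
  rw [this]
  ring

end

/-! ### Exponential and polynomial moments of the norm of a subgaussian series -/

section

variable {ι : Type} [Fintype ι] [DecidableEq ι] {κ : ι → Type} [∀ i, Fintype (κ i)]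
  [∀ i, DecidableEq (κ i)] {K : Type} [Fintype K]

/-- The variational inequality is applied to the translate by a maximizer, which may depend on the
coefficients `c`; the right side no longer involves it. -/
theorem ofReal_exp_injNorm_le_lintegral {v : NNReal} (hv : v ≠ 0) (B : K → Tensor κ)
    {M : Finset ι → ℝ}
    (hM : ∀ J, ∀ x : ∀ i, EuclideanSpace ℝ (κ i), (∀ i, ‖x i‖ ≤ 1) →
      ∑ k, partialSq J (B k) (fun i j => x i j) ≤ M J ^ 2) (l : ℝ) (c : K → ℝ) :
    ENNReal.ofReal (Real.exp (l * (∑ k, c k • B k).injNorm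
        - l ^ 2 / 2 * ∑ J, (v : ℝ) ^ (Jᶜ).card * M J ^ 2 - Fintype.card ι / (2 * v))) ≤
      ∫⁻ X, ENNReal.ofReal (Real.exp (∑ k, (l * (B k).form X * c k - (l * (B k).form X) ^ 2 / 2)))
        ∂gaussianProduct v (0 : ∀ i, κ i → ℝ) := by
  obtain ⟨x, hx, hxA⟩ := exists_injNorm_eq_eval (∑ k, c k • B k)
  have hi : ∀ k, Integrable (fun X => l * (B k).form X * c k - (l * (B k).form X) ^ 2 / 2)
      (gaussianProduct v fun i j => x i j) := fun k => by
    simp_rw [mul_pow]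
    exact (((integrable_form v _ (B k)).const_mul l).mul_const _).sub
      (((integrable_form_sq v _ (B k)).const_mul _).div_const _)
  refine le_trans (ENNReal.ofReal_le_ofReal (Real.exp_le_exp.2 ?_))
    (ofReal_exp_integral_sub_le_lintegral hv (fun i j => x i j)
      (integrable_finsetSum _ fun k _ => hi k)
      (Finset.measurable_fun_sum _ fun k _ => by
        have := measurable_form (B k)
        fun_prop))
  rw [integral_finsetSum _ fun k _ => hi k]
  have h1 : ∀ k, ∫ X, (l * (B k).form X * c k - (l * (B k).form X) ^ 2 / 2)
      ∂gaussianProduct v (fun i j => x i j) = l * (c k * (B k).form (fun i j => x i j)) -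
        l ^ 2 / 2 * ∑ J, (v : ℝ) ^ (Jᶜ).card * partialSq J (B k) (fun i j => x i j) := by
    intro k
    simp_rw [mul_pow]
    rw [integral_sub (((integrable_form v _ (B k)).const_mul l).mul_const _)
      (((integrable_form_sq v _ (B k)).const_mul _).div_const _), integral_mul_const,
      integral_const_mul, integral_div, integral_const_mul, integral_form, integral_form_sq]
    ring
  simp_rw [h1]
  rw [Finset.sum_sub_distrib, ← Finset.mul_sum, ← form_sum_smul, form_ofLp, ← hxA,
    ← Finset.mul_sum, Finset.sum_comm]
  have h2 : ∑ J, ∑ k, (v : ℝ) ^ (Jᶜ).card * partialSq J (B k) (fun i j => x i j) ≤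
      ∑ J, (v : ℝ) ^ (Jᶜ).card * M J ^ 2 := by
    refine Finset.sum_le_sum fun J _ => ?_
    rw [← Finset.mul_sum]
    exact mul_le_mul_of_nonneg_left (hM J x hx) (by positivity)
  have h3 : (∑ i, ∑ j, x i j ^ 2) / (2 * (v : ℝ)) ≤ Fintype.card ι / (2 * v) := by
    gcongr
    refine (Finset.sum_le_sum (g := fun _ => (1 : ℝ)) fun i _ => ?_).trans (by simp)
    rw [← EuclideanSpace.real_norm_sq_eq]
    exact pow_le_one₀ (norm_nonneg _) (hx i)
  have h4 := mul_le_mul_of_nonneg_left h2 (by positivity : 0 ≤ l ^ 2 / 2)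
  linarith

end

end Tensor

section

variable {K : Type*} [Fintype K]
  {Ω : Type*} [MeasurableSpace Ω] {μ : Measure Ω} {ξ : K → Ω → ℝ}

/-- By independence ∑ a_k ξ_k is subgaussian with variance proxy ∑ a_k², which the subtracted
squares compensate exactly. -/
theorem lintegral_exp_sum_le_one (hind : iIndepFun ξ μ) (hξ : ∀ k, HasSubgaussianMGF (ξ k) 1 μ)
    (a : K → ℝ) :
    ∫⁻ ω, ENNReal.ofReal (Real.exp (∑ k, (a k * ξ k ω - a k ^ 2 / 2))) ∂μ ≤ 1 := by
  have hs : HasSubgaussianMGF (fun ω => ∑ k, a k * ξ k ω)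
      (∑ k, (⟨a k ^ 2, sq_nonneg _⟩ * 1 : NNReal)) μ :=
    HasSubgaussianMGF.sum_of_iIndepFun
      (hind.comp (fun k y => a k * y) fun k => measurable_const_mul (a k))
      fun k _ => (hξ k).const_mul (a k)
  have hm := hs.mgf_le 1
  have hi := hs.integrable_exp_mul 1
  rw [mgf] at hm
  simp_rw [one_mul] at hm hi
  have h1 : ∀ ω, Real.exp (∑ k, (a k * ξ k ω - a k ^ 2 / 2)) =
      Real.exp (∑ k, a k * ξ k ω) * Real.exp (- ((∑ k, a k ^ 2) / 2)) := fun ω => by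
    rw [← Real.exp_add, Finset.sum_sub_distrib, Finset.sum_div]; rfl
  simp_rw [h1]
  rw [← ofReal_integral_eq_lintegral_ofReal (hi.mul_const _) (ae_of_all _ fun ω => by positivity),
    integral_mul_const]
  refine ENNReal.ofReal_le_one.2 ((mul_le_mul_of_nonneg_right hm (Real.exp_pos _).le).trans ?_)
  rw [← Real.exp_add]
  refine (Real.exp_le_exp.2 (le_of_eq ?_)).trans_eq Real.exp_zero
  have h2 : ∀ k, ((⟨a k ^ 2, sq_nonneg _⟩ * 1 : NNReal) : ℝ) = a k ^ 2 := fun k =>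
    mul_one (a k ^ 2)
  rw [NNReal.coe_sum]
  simp_rw [h2]
  ring

end

namespace Tensor

set_option linter.unusedSectionVars false

variable {ι : Type} [Fintype ι] [DecidableEq ι] {κ : ι → Type} [∀ i, Fintype (κ i)]
  [∀ i, DecidableEq (κ i)] {K : Type} [Fintype K]
  {Ω : Type*} [MeasurableSpace Ω] {μ : Measure Ω} {ξ : K → Ω → ℝ}

theorem lintegral_exp_injNorm_le [IsProbabilityMeasure μ] (hind : iIndepFun ξ μ)
    (hξ : ∀ k, HasSubgaussianMGF (ξ k) 1 μ) {v : NNReal} (hv : v ≠ 0) (B : K → Tensor κ)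
    {M : Finset ι → ℝ}
    (hM : ∀ J, ∀ x : ∀ i, EuclideanSpace ℝ (κ i), (∀ i, ‖x i‖ ≤ 1) →
      ∑ k, partialSq J (B k) (fun i j => x i j) ≤ M J ^ 2) (l : ℝ) :
    ∫⁻ ω, ENNReal.ofReal (Real.exp (l * (∑ k, ξ k ω • B k).injNorm)) ∂μ ≤
      ENNReal.ofReal (Real.exp (l ^ 2 / 2 * ∑ J, (v : ℝ) ^ (Jᶜ).card * M J ^ 2
        + Fintype.card ι / (2 * v))) := by
  set s := l ^ 2 / 2 * ∑ J, (v : ℝ) ^ (Jᶜ).card * M J ^ 2 + Fintype.card ι / (2 * v) with hs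
  have h1 : ∀ ω, ENNReal.ofReal (Real.exp (l * (∑ k, ξ k ω • B k).injNorm)) ≤
      ENNReal.ofReal (Real.exp s) * ∫⁻ X, ENNReal.ofReal (Real.exp
        (∑ k, (l * (B k).form X * ξ k ω - (l * (B k).form X) ^ 2 / 2)))
        ∂gaussianProduct v (0 : ∀ i, κ i → ℝ) := fun ω => by
    refine le_trans (le_of_eq ?_) (mul_le_mul_right
      (ofReal_exp_injNorm_le_lintegral hv B hM l fun k => ξ k ω) _)
    rw [← ENNReal.ofReal_mul (Real.exp_pos _).le, ← Real.exp_add, hs]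
    congr 2
    ring
  refine (lintegral_mono h1).trans ?_
  rw [lintegral_const_mul' _ _ ENNReal.ofReal_ne_top, lintegral_lintegral_swap]
  · refine (mul_le_mul_right ((lintegral_mono fun X =>
      lintegral_exp_sum_le_one hind hξ fun k => l * (B k).form X).trans ?_) _).trans_eq (mul_one _)
    simp
  · have h2 : ∀ k, AEMeasurable (fun q : Ω × (∀ i, κ i → ℝ) => ξ k q.1)
        (μ.prod (gaussianProduct v (0 : ∀ i, κ i → ℝ))) := fun k => (hξ k).aemeasurable.comp_fst
    have h3 : ∀ k, Measurable fun q : Ω × (∀ i, κ i → ℝ) => (B k).form q.2 := fun k =>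
      (measurable_form (B k)).comp measurable_snd
    refine ENNReal.measurable_ofReal.comp_aemeasurable (Real.measurable_exp.comp_aemeasurable
      (Finset.aemeasurable_fun_sum _ fun k _ => ?_))
    have h4 := ((h3 k).aemeasurable (μ := μ.prod (gaussianProduct v 0))).const_mul l
    exact (h4.mul (h2 k)).sub ((h4.pow_const 2).div_const 2)

theorem aestronglyMeasurable_injNorm_sum (hξ : ∀ k, HasSubgaussianMGF (ξ k) 1 μ)
    (B : K → Tensor κ) : AEStronglyMeasurable (fun ω => (∑ k, ξ k ω • B k).injNorm) μ := by
  refine continuous_injNorm.comp_aestronglyMeasurable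
    (Finset.aestronglyMeasurable_fun_sum _ fun k _ => ?_)
  exact (hξ k).aestronglyMeasurable.smul_const _

/-- The exponential moment is taken at l = p/S with v = 1/p, which makes the exponent at most (m +
1)p/2 for m modes. A strictly positive upper bound S replaces the sum, which may vanish, so that
division by it is allowed. -/
theorem moment_injNorm_le_of_pos [Nonempty ι] [IsProbabilityMeasure μ] (hind : iIndepFun ξ μ)
    (hξ : ∀ k, HasSubgaussianMGF (ξ k) 1 μ) (B : K → Tensor κ) {M : Finset ι → ℝ}
    (hM0 : ∀ J, 0 ≤ M J)
    (hM : ∀ J, ∀ x : ∀ i, EuclideanSpace ℝ (κ i), (∀ i, ‖x i‖ ≤ 1) →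
      ∑ k, partialSq J (B k) (fun i j => x i j) ≤ M J ^ 2) {p : ℝ} (hp : 0 < p) {S : ℝ}
    (hS0 : 0 < S)
    (hS : ∑ J : Finset ι, p ^ ((J.card + 1 - Fintype.card ι : ℝ) / 2) * M J ≤ S) :
    Integrable (fun ω => (∑ k, ξ k ω • B k).injNorm ^ p) μ ∧
      (∫ ω, (∑ k, ξ k ω • B k).injNorm ^ p ∂μ) ^ (1 / p) ≤
        Real.exp ((Fintype.card ι + 1) / 2) * S := by
  obtain ⟨v, hv⟩ : ∃ v : NNReal, (v : ℝ) = p⁻¹ := ⟨⟨p⁻¹, by positivity⟩, rfl⟩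
  have hv0 : v ≠ 0 := by
    rintro rfl
    exact (inv_pos.2 hp).ne (by simpa using hv)
  -- For v = 1/p each term on the left is the square of the corresponding term of the sum in `hS`.
  have hV : p * ∑ J, (v : ℝ) ^ (Jᶜ).card * M J ^ 2 ≤ S ^ 2 := by
    refine le_trans (le_trans (le_of_eq ?_) (Finset.sum_sq_le_sq_sum_of_nonneg (s := Finset.univ)
      fun J _ => mul_nonneg (Real.rpow_nonneg hp.le _) (hM0 J)))
      (pow_le_pow_left₀ (Finset.sum_nonneg fun J _ =>
        mul_nonneg (Real.rpow_nonneg hp.le _) (hM0 J)) hS 2)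
    rw [Finset.mul_sum]
    refine Finset.sum_congr rfl fun J _ => ?_
    have hJ : (J.card : ℝ) + (Jᶜ).card = Fintype.card ι := by
      exact_mod_cast J.card_add_card_compl
    rw [mul_pow, ← mul_assoc, hv, inv_pow, ← Real.rpow_natCast p, ← Real.rpow_neg hp.le,
      ← Real.rpow_mul_natCast hp.le, ← hJ]
    congr 1
    nth_rw 1 [← Real.rpow_one p]
    rw [← Real.rpow_add hp]
    congr 1; push_cast; ring
  have hexp := lintegral_exp_injNorm_le hind hξ hv0 B hM (p / S)
  set s : ℝ := (p / S) ^ 2 / 2 * ∑ J, (v : ℝ) ^ (Jᶜ).card * M J ^ 2 + Fintype.card ι / (2 * v)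
    with hs
  have hs' : s ≤ (Fintype.card ι + 1) / 2 * p := by
    have h1 : (p / S) ^ 2 / 2 * ∑ J, (v : ℝ) ^ (Jᶜ).card * M J ^ 2 ≤ p / 2 := by
      calc _ = p / (2 * S ^ 2) * (p * ∑ J, (v : ℝ) ^ (Jᶜ).card * M J ^ 2) := by
            field_simp
        _ ≤ p / (2 * S ^ 2) * S ^ 2 := by gcongr
        _ = p / 2 := by field_simp
    have h2 : Fintype.card ι / (2 * (v : ℝ)) = Fintype.card ι * p / 2 := by
      rw [hv]; field_simp
    rw [hs, h2]
    linarith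
  have hmeas := aestronglyMeasurable_injNorm_sum hξ B
  have hE : Integrable (fun ω => Real.exp (p / S * (∑ k, ξ k ω • B k).injNorm)) μ :=
    (lintegral_ofReal_ne_top_iff_integrable
      (Real.continuous_exp.comp_aestronglyMeasurable (hmeas.const_mul _))
      (ae_of_all _ fun a => (Real.exp_pos _).le)).1
      (ne_top_of_le_ne_top ENNReal.ofReal_ne_top hexp)
  have hEle : ∫ ω, Real.exp (p / S * (∑ k, ξ k ω • B k).injNorm) ∂μ ≤
      Real.exp ((Fintype.card ι + 1) / 2 * p) := by
    rw [← ofReal_integral_eq_lintegral_ofReal hE (ae_of_all _ fun a => (Real.exp_pos _).le),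
      ENNReal.ofReal_le_ofReal_iff (Real.exp_pos _).le] at hexp
    exact hexp.trans (Real.exp_le_exp.2 hs')
  -- This is the p-th power of u ≤ S e^(u/S).
  have hpt : ∀ ω, (∑ k, ξ k ω • B k).injNorm ^ p ≤
      S ^ p * Real.exp (p / S * (∑ k, ξ k ω • B k).injNorm) := fun ω => by
    set u := (∑ k, ξ k ω • B k).injNorm
    have hu : 0 ≤ u := injNorm_nonneg _
    have h1 : u ≤ S * Real.exp (u / S) := by
      have h2 := Real.add_one_le_exp (u / S)
      calc u = S * (u / S) := by field_simp
        _ ≤ _ := by gcongr; linarith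
    calc u ^ p ≤ (S * Real.exp (u / S)) ^ p := Real.rpow_le_rpow hu h1 hp.le
      _ = _ := by
        rw [Real.mul_rpow hS0.le (Real.exp_pos _).le, ← Real.exp_mul]
        congr 2
        field_simp
  have hI : Integrable (fun ω => (∑ k, ξ k ω • B k).injNorm ^ p) μ :=
    (hE.const_mul (S ^ p)).mono' (hmeas.aemeasurable.pow_const p).aestronglyMeasurable
      (ae_of_all _ fun ω => by
        rw [Real.norm_of_nonneg (Real.rpow_nonneg (injNorm_nonneg _) _)]; exact hpt ω)
  refine ⟨hI, ?_⟩
  have h1 : ∫ ω, (∑ k, ξ k ω • B k).injNorm ^ p ∂μ ≤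
      (Real.exp ((Fintype.card ι + 1) / 2) * S) ^ p := by
    refine (integral_mono hI (hE.const_mul (S ^ p)) hpt).trans ?_
    rw [integral_const_mul, Real.mul_rpow (Real.exp_pos _).le hS0.le, ← Real.exp_mul, mul_comm]
    gcongr
  calc _ ≤ ((Real.exp ((Fintype.card ι + 1) / 2) * S) ^ p) ^ (1 / p) :=
        Real.rpow_le_rpow (integral_nonneg fun ω => Real.rpow_nonneg (injNorm_nonneg _) _) h1
          (by positivity)
    _ = _ := by
        rw [one_div, Real.rpow_rpow_inv (by positivity) hp.ne']

/-- The moment bound for the injective norm of a subgaussian series of tensors. -/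
theorem moment_injNorm_le [Nonempty ι] [IsProbabilityMeasure μ] (hind : iIndepFun ξ μ)
    (hξ : ∀ k, HasSubgaussianMGF (ξ k) 1 μ) (B : K → Tensor κ) {M : Finset ι → ℝ}
    (hM0 : ∀ J, 0 ≤ M J)
    (hM : ∀ J, ∀ x : ∀ i, EuclideanSpace ℝ (κ i), (∀ i, ‖x i‖ ≤ 1) →
      ∑ k, partialSq J (B k) (fun i j => x i j) ≤ M J ^ 2) {p : ℝ} (hp : 0 < p) :
    Integrable (fun ω => (∑ k, ξ k ω • B k).injNorm ^ p) μ ∧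
      (∫ ω, (∑ k, ξ k ω • B k).injNorm ^ p ∂μ) ^ (1 / p) ≤
        Real.exp ((Fintype.card ι + 1) / 2) *
          ∑ J : Finset ι, p ^ ((J.card + 1 - Fintype.card ι : ℝ) / 2) * M J := by
  set S := ∑ J : Finset ι, p ^ ((J.card + 1 - Fintype.card ι : ℝ) / 2) * M J
  have hS : 0 ≤ S := Finset.sum_nonneg fun J _ => mul_nonneg (Real.rpow_nonneg hp.le _) (hM0 J)
  refine ⟨(moment_injNorm_le_of_pos hind hξ B hM0 hM hp (S := S + 1) (by positivity)
    (by linarith)).1, le_of_forall_pos_le_add fun ε hε => ?_⟩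
  -- The slack is scaled so that the constant factor turns it into exactly ε.
  have := (moment_injNorm_le_of_pos hind hξ B hM0 hM hp
    (S := S + ε / Real.exp ((Fintype.card ι + 1) / 2)) (by positivity)
    (le_add_of_nonneg_right (by positivity))).2
  rwa [mul_add, mul_div_cancel₀ _ (Real.exp_pos _).ne'] at this

end Tensor

/-! ### Partial Hilbert–Schmidt norms and regrouped tensors -/

namespace Tensor

section

variable {ι : Type} [Fintype ι] [DecidableEq ι] {κ : ι → Type} [∀ i, Fintype (κ i)]
  [∀ i, DecidableEq (κ i)]

/-- Evaluating all modes but `b` leaves a vector c whose squared norm is the left side; testing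
against c/‖c‖ in mode `b` gives ‖c‖ by duality. -/
theorem partialSq_compl_singleton_le [Nonempty ι] (b : ι) (A : Tensor κ)
    (x : ∀ i, EuclideanSpace ℝ (κ i)) (hx : ∀ i, ‖x i‖ ≤ 1) :
    partialSq {b}ᶜ A (fun i j => x i j) ≤ A.injNorm ^ 2 := by
  set w : (∀ i, κ i) → ℝ := fun j => A j * ∏ i ∈ ({b}ᶜ : Finset ι), x i (j i) with hw
  set c : EuclideanSpace ℝ (κ b) := WithLp.toLp 2 fun g => ∑ j, if j b = g then w j else 0 with hc
  have hcg : ∀ g, c g = ∑ j, if j b = g then w j else 0 := fun g => rfl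
  have hS : partialSq {b}ᶜ A (fun i j => x i j) = ∑ j, w j * c (j b) := by
    unfold partialSq
    refine Finset.sum_congr rfl fun j _ => ?_
    rw [hcg, Finset.mul_sum]
    refine Finset.sum_congr rfl fun j' _ => ?_
    rw [Fintype.prod_eq_mul_prod_compl b, if_neg (by simp),
      Finset.prod_congr rfl fun i hi => if_pos hi, Finset.prod_mul_distrib]
    simp only [hw, eq_comm (a := j b)]
    split_ifs <;> ring
  have hn : ∑ j, w j * c (j b) = ‖c‖ ^ 2 := by
    rw [EuclideanSpace.real_norm_sq_eq]
    simp_rw [sq]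
    conv_rhs => enter [2, g]; rw [hcg g, Finset.sum_mul]
    rw [Finset.sum_comm]
    refine Finset.sum_congr rfl fun j _ => ?_
    simp only [ite_mul, zero_mul, Finset.sum_ite_eq, Finset.mem_univ, if_true]
    rw [hcg]
  rw [hS, hn]
  refine pow_le_pow_left₀ (norm_nonneg _) ?_ 2
  rcases eq_or_ne ‖c‖ 0 with h0 | h0
  · rw [h0]; exact injNorm_nonneg A
  refine le_trans (le_of_eq ?_) (eval_le_injNorm A (Function.update x b (‖c‖⁻¹ • c)) fun i => ?_)
  · have h1 : A.eval (Function.update x b (‖c‖⁻¹ • c)) = ‖c‖⁻¹ * ∑ j, w j * c (j b) := by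
      rw [eval, Finset.mul_sum]
      refine Finset.sum_congr rfl fun j _ => ?_
      rw [Fintype.prod_eq_mul_prod_compl b, Function.update_self,
        Finset.prod_congr rfl fun i (hi : i ∈ ({b}ᶜ : Finset ι)) => by
          rw [Function.update_of_ne (by simpa using hi)]]
      simp only [hw, PiLp.smul_apply, smul_eq_mul]
      ring
    rw [h1, hn]
    field_simp
  · rcases eq_or_ne i b with rfl | hi
    · rw [Function.update_self, norm_smul, norm_inv, norm_norm, inv_mul_cancel₀ h0]
    · rw [Function.update_of_ne hi]; exact hx i

end

section

variable {ι : Type} [Fintype ι] [DecidableEq ι] {κ : ι → Type}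

/-- Tuples indexed by all modes are the same as families of tuples indexed by the blocks. -/
def blockEquiv (P : Finpartition (Finset.univ : Finset ι)) :
    (∀ t, κ t) ≃ (∀ I : P.parts, ∀ t : I.1, κ t) where
  toFun j := fun _ t => j t
  invFun j := fun t =>
    j ⟨P.part t, P.part_mem.2 (Finset.mem_univ t)⟩ ⟨t, P.mem_part (Finset.mem_univ t)⟩
  left_inv _ := rfl
  right_inv j := by
    ext ⟨I, hI⟩ ⟨t, ht⟩
    obtain rfl : P.part t = I := P.part_eq_of_mem hI ht
    rfl

theorem partialSq_regroup [∀ i, Fintype (κ i)] [∀ i, DecidableEq (κ i)]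
    (P : Finpartition (Finset.univ : Finset ι)) (J : Finset P.parts) (A : Tensor κ)
    (x : ∀ I : P.parts, (∀ t : I.1, κ t) → ℝ) :
    partialSq J (regroup P A) x = ∑ j, ∑ j', A j * A j' * ∏ I : P.parts,
      if I ∈ J then (x I fun t => j t) * x I fun t => j' t
      else if (fun t : I.1 => j t) = (fun t : I.1 => j' t) then 1 else 0 := by
  unfold partialSq
  rw [← (blockEquiv P).sum_comp]
  refine Finset.sum_congr rfl fun j _ => ?_
  rw [← (blockEquiv P).sum_comp]
  rfl

end

/-! ### The partition of the stacked modes attached to a set of blocks -/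

section

variable {N : ℕ}

/-- A set of modes of the slices, as a set of modes of the stacked tensor. -/
def liftBlock (I : Finset (Fin N)) : Finset (Fin (N + 1)) := I.map Fin.castSuccEmb

theorem castSucc_mem_liftBlock {I : Finset (Fin N)} {t : Fin N} :
    t.castSucc ∈ liftBlock I ↔ t ∈ I := by
  simp [liftBlock]

theorem last_notMem_liftBlock (I : Finset (Fin N)) : Fin.last N ∉ liftBlock I := by
  simp [liftBlock, Fin.castSucc_ne_last]

theorem liftBlock_injective : Function.Injective (liftBlock (N := N)) :=
  Finset.map_injective _

variable (P : Finpartition (Finset.univ : Finset (Fin N))) (J : Finset P.parts)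

/-- The modes of the stacked tensor outside the blocks in `J`. -/
def restBlock : Finset (Fin (N + 1)) := Finset.univ \ J.biUnion fun I => liftBlock I.1

theorem last_mem_restBlock : Fin.last N ∈ restBlock P J := by
  simp [restBlock, last_notMem_liftBlock]

theorem castSucc_mem_restBlock {t : Fin N} :
    t.castSucc ∈ restBlock P J ↔ ∀ I ∈ J, t ∉ I.1 := by
  simp [restBlock, castSucc_mem_liftBlock]

/-- The partition made of the blocks in `J` and of one block that contains all other modes. -/
def stackPartition : Finpartition (Finset.univ : Finset (Fin (N + 1))) :=
  (Finpartition.mk (a := J.biUnion fun I => liftBlock I.1) (J.image fun I => liftBlock I.1)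
    (by
      rw [Finset.supIndep_iff_pairwiseDisjoint]
      intro a ha b hb hab
      simp only [Finset.coe_image, Set.mem_image, Finset.mem_coe] at ha hb
      obtain ⟨I, -, rfl⟩ := ha
      obtain ⟨I', -, rfl⟩ := hb
      refine (Finset.disjoint_map _).2 (P.disjoint I.2 I'.2 fun h => hab ?_)
      rw [h])
    (by rw [Finset.sup_image, Finset.sup_eq_biUnion]; rfl)
    (by
      simp only [Finset.bot_eq_empty, Finset.mem_image, not_exists, not_and]
      intro I _ h
      exact P.ne_bot I.2 (Finset.map_eq_empty.1 h))).extend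
    (b := restBlock P J) (Finset.ne_empty_of_mem (last_mem_restBlock P J)) Finset.disjoint_sdiff
    (by simp [restBlock])

theorem stackPartition_parts :
    (stackPartition P J).parts = insert (restBlock P J) (J.image fun I => liftBlock I.1) := rfl

/-- The remaining block contains the last mode, hence differs from every lifted block. This count
matches the exponents of p. -/
theorem card_stackPartition : (stackPartition P J).parts.card = J.card + 1 := by
  rw [stackPartition_parts, Finset.card_insert_of_notMem, Finset.card_image_of_injective]
  · exact liftBlock_injective.comp Subtype.val_injective
  · simp only [Finset.mem_image, not_exists, not_and]
    intro I _ h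
    exact last_notMem_liftBlock I.1 (h ▸ last_mem_restBlock P J)

end

end Tensor

/-! ### Comparison of slice sums with the stacked tensor -/

namespace Tensor

theorem norm_toLp_comp_le {α β : Type} [Fintype α] [Fintype β] (x : EuclideanSpace ℝ β)
    {f : α → β} (hf : Function.Injective f) : ‖WithLp.toLp 2 fun a => x (f a)‖ ≤ ‖x‖ := by
  classical
  refine (sq_le_sq₀ (norm_nonneg _) (norm_nonneg _)).1 ?_
  rw [EuclideanSpace.real_norm_sq_eq, EuclideanSpace.real_norm_sq_eq,
    ← Finset.sum_image (s := Finset.univ) (g := f) (f := fun b => x b ^ 2) hf.injOn]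
  exact Finset.sum_le_sum_of_subset_of_nonneg (Finset.subset_univ _) fun _ _ _ => sq_nonneg _

variable {N d n : ℕ}

/-- The index tuples of a stacked tensor are pairs of a slice and an index tuple of that slice. -/
def stackEquiv : (∀ t, Fin (stackDim N d n t)) ≃ Fin n × (Fin N → Fin d) :=
  (Fin.snocEquiv fun t => Fin (stackDim N d n t)).symm.trans
    ((finCongr (stackDim_last N d n)).prodCongr
      (Equiv.piCongrRight fun t => finCongr (stackDim_castSucc N d n t)))

theorem stack_eq (T : Fin n → Tensor (fun _ : Fin N => Fin d))
    (s : ∀ t, Fin (stackDim N d n t)) : stack T s = T (stackEquiv s).1 (stackEquiv s).2 := rfl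

theorem stackEquiv_fst_eq_iff (s s' : ∀ t, Fin (stackDim N d n t)) :
    (stackEquiv s).1 = (stackEquiv s').1 ↔ s (Fin.last N) = s' (Fin.last N) :=
  (finCongr (stackDim_last N d n)).injective.eq_iff

theorem stackEquiv_snd_eq_iff (s s' : ∀ t, Fin (stackDim N d n t)) (t : Fin N) :
    (stackEquiv s).2 t = (stackEquiv s').2 t ↔ s t.castSucc = s' t.castSucc :=
  (finCongr (stackDim_castSucc N d n t)).injective.eq_iff

variable (P : Finpartition (Finset.univ : Finset (Fin N))) (J : Finset P.parts)

/-- The restriction of an index tuple of the stacked tensor, as an index tuple on a block of `P`. -/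
def pullIndex (I : P.parts) {I' : Finset (Fin (N + 1))} (h : liftBlock I.1 = I')
    (g : ∀ t : I', Fin (stackDim N d n t)) : ∀ _ : I.1, Fin d := fun t =>
  Fin.cast (stackDim_castSucc N d n t) (g ⟨t.1.castSucc, h ▸ castSucc_mem_liftBlock.2 t.2⟩)

theorem pullIndex_injective (I : P.parts) {I' : Finset (Fin (N + 1))} (h : liftBlock I.1 = I') :
    Function.Injective (pullIndex (d := d) (n := n) P I h) := by
  subst h
  intro g g' hg
  ext ⟨t, ht⟩
  obtain ⟨u, hu, rfl⟩ := Finset.mem_map.1 ht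
  have := congrFun hg ⟨u, hu⟩
  simpa [pullIndex, Fin.ext_iff] using this

open Classical in
/-- Vectors on the blocks of `stackPartition P J` that agree with `x` on the blocks in `J`. -/
noncomputable def pushVectors (x : ∀ I : P.parts, EuclideanSpace ℝ (∀ _ : I.1, Fin d)) :
    ∀ I' : (stackPartition P J).parts,
      EuclideanSpace ℝ (∀ t : I'.1, Fin (stackDim N d n t)) := fun I' =>
  if h : ∃ I ∈ J, liftBlock I.1 = I'.1 then
    WithLp.toLp 2 fun g => x h.choose (pullIndex P h.choose h.choose_spec.2 g)
  -- Only the remaining block gets this value, and the form is never evaluated there: that block is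
  -- the contracted one.
  else 0

variable (x : ∀ I : P.parts, EuclideanSpace ℝ (∀ _ : I.1, Fin d))

theorem norm_pushVectors_le (hx : ∀ I, ‖x I‖ ≤ 1) (I' : (stackPartition P J).parts) :
    ‖pushVectors (n := n) P J x I'‖ ≤ 1 := by
  unfold pushVectors
  split_ifs with h
  · exact (norm_toLp_comp_le _ (pullIndex_injective P _ h.choose_spec.2)).trans (hx _)
  · simp

theorem pushVectors_apply (s : ∀ t, Fin (stackDim N d n t)) {I : P.parts} (hI : I ∈ J)
    {I' : (stackPartition P J).parts} (h : liftBlock I.1 = I'.1) :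
    pushVectors P J x I' (fun t => s t) = x I fun t => (stackEquiv s).2 t := by
  have h' : ∃ I ∈ J, liftBlock I.1 = I'.1 := ⟨I, hI, h⟩
  have hc : h'.choose = I :=
    Subtype.ext (liftBlock_injective (h'.choose_spec.2.trans h.symm))
  unfold pushVectors
  rw [dif_pos h']
  exact congrArg (fun I : P.parts => x I fun t => (stackEquiv s).2 t) hc

/-- A mode of the remaining block is either the last one or lies in a unique block of `P` outside
`J`. -/
theorem restrict_restBlock_eq_iff (s s' : ∀ t, Fin (stackDim N d n t)) :
    ((fun t : restBlock P J => s t) = fun t : restBlock P J => s' t) ↔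
      (stackEquiv s).1 = (stackEquiv s').1 ∧ ∀ I ∈ Jᶜ,
        (fun t : I.1 => (stackEquiv s).2 t) = fun t : I.1 => (stackEquiv s').2 t := by
  simp only [funext_iff, stackEquiv_fst_eq_iff, stackEquiv_snd_eq_iff, Subtype.forall]
  refine ⟨fun h => ⟨h _ (last_mem_restBlock P J), fun I hIP hI t ht =>
    h _ ((castSucc_mem_restBlock P J).2 fun I' hI' ht' => ?_)⟩, fun h t => ?_⟩
  · refine Finset.mem_compl.1 hI ?_
    have : (⟨I, hIP⟩ : P.parts) = I' := Subtype.ext (P.eq_of_mem_parts hIP I'.2 ht ht')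
    rwa [this]
  · induction t using Fin.lastCases with
    | last => exact fun _ => h.1
    | cast t =>
      intro ht
      refine h.2 (P.part t) (P.part_mem.2 (Finset.mem_univ t)) (Finset.mem_compl.2 fun hJ => ?_) t
        (P.mem_part (Finset.mem_univ t))
      exact (castSucc_mem_restBlock P J).1 ht _ hJ (P.mem_part (Finset.mem_univ t))

/-- The Kronecker delta on the merged block factors into one for the slice index and one for each
block outside `J`. -/
theorem prod_stackPartition (s s' : ∀ t, Fin (stackDim N d n t))
    {b : (stackPartition P J).parts} (hb : b.1 = restBlock P J) :
    (∏ I : (stackPartition P J).parts, if I ∈ ({b}ᶜ : Finset (stackPartition P J).parts) then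
        (pushVectors P J x I fun t => s t) * pushVectors P J x I fun t => s' t
      else if (fun t : I.1 => s t) = (fun t : I.1 => s' t) then 1 else 0) =
    if (stackEquiv s).1 = (stackEquiv s').1 then
      ∏ I : P.parts, if I ∈ J then
        (x I fun t => (stackEquiv s).2 t) * x I fun t => (stackEquiv s').2 t
      else if (fun t : I.1 => (stackEquiv s).2 t) = (fun t : I.1 => (stackEquiv s').2 t)
        then 1 else 0
    else 0 := by
  have h1 : (∏ I ∈ ({b}ᶜ : Finset (stackPartition P J).parts),
      (pushVectors P J x I fun t => s t) * pushVectors P J x I fun t => s' t) =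
      ∏ I ∈ J, (x I fun t => (stackEquiv s).2 t) * x I fun t => (stackEquiv s').2 t := by
    symm
    have hmem : ∀ I ∈ J, liftBlock I.1 ∈ (stackPartition P J).parts := fun I hI => by
      rw [stackPartition_parts]
      exact Finset.mem_insert_of_mem (Finset.mem_image_of_mem _ hI)
    refine Finset.prod_bij (fun I hI => ⟨liftBlock I.1, hmem I hI⟩) ?_ ?_ ?_ ?_
    · intro I hI
      rw [Finset.mem_compl, Finset.mem_singleton, Subtype.ext_iff, hb]
      intro h
      have h' : liftBlock I.1 = restBlock P J := h
      exact last_notMem_liftBlock I.1 (h' ▸ last_mem_restBlock P J)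
    · intro I _ I' _ h
      exact Subtype.ext (liftBlock_injective (Subtype.ext_iff.1 h))
    · rintro ⟨I', hI'⟩ hne
      rw [Finset.mem_compl, Finset.mem_singleton, Subtype.ext_iff, hb] at hne
      have hI'' := hI'
      rw [stackPartition_parts, Finset.mem_insert] at hI''
      obtain ⟨I, hI, rfl⟩ := Finset.mem_image.1 (hI''.resolve_left hne)
      exact ⟨I, hI, rfl⟩
    · intro I hI
      rw [pushVectors_apply P J x s hI rfl, pushVectors_apply P J x s' hI rfl]
  rw [Fintype.prod_eq_mul_prod_compl b, if_neg (by simp),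
    Finset.prod_congr rfl fun I hI => if_pos hI, h1, ← Finset.prod_mul_prod_compl J,
    Finset.prod_congr rfl fun i (hi : i ∈ J) => if_pos hi,
    Finset.prod_congr rfl fun i (hi : i ∈ Jᶜ) => if_neg (Finset.mem_compl.1 hi),
    Finset.prod_ite_zero]
  obtain ⟨b, hbQ⟩ := b
  dsimp only at hb ⊢
  subst hb
  simp only [restrict_restBlock_eq_iff, Finset.prod_const_one]
  by_cases h : (stackEquiv s).1 = (stackEquiv s').1
  · simp only [h, true_and, if_true]
    rw [mul_comm]
  · simp [h]

/-- Summing squares over k is a Hilbert–Schmidt contraction of the stacking index, so it merges with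
the contracted blocks into a single mode, to which the duality bound applies. -/
theorem sum_partialSq_regroup_le (T : Fin n → Tensor (fun _ : Fin N => Fin d))
    (hx : ∀ I, ‖x I‖ ≤ 1) :
    ∑ k, partialSq J (regroup P (T k)) (fun I j => x I j) ≤
      (regroup (stackPartition P J) (stack T)).injNorm ^ 2 := by
  have hbQ : restBlock P J ∈ (stackPartition P J).parts := by
    rw [stackPartition_parts]; exact Finset.mem_insert_self _ _
  have : Nonempty (stackPartition P J).parts := ⟨⟨_, hbQ⟩⟩
  refine le_trans (le_of_eq ?_) (partialSq_compl_singleton_le ⟨restBlock P J, hbQ⟩ _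
    (pushVectors P J x) (norm_pushVectors_le P J x hx))
  refine (Finset.sum_congr rfl fun k _ => partialSq_regroup P J (T k) _).trans
    (Eq.trans ?_ (partialSq_regroup (κ := fun t => Fin (stackDim N d n t)) (stackPartition P J)
      _ (stack T) fun i j => pushVectors P J x i j).symm)
  simp_rw [prod_stackPartition P J x _ _ (b := ⟨restBlock P J, hbQ⟩) rfl, stack_eq]
  set L : (Fin N → Fin d) → (Fin N → Fin d) → ℝ := fun j j' => ∏ I : P.parts, if I ∈ J then
        (x I fun t => j t) * x I fun t => j' t
      else if (fun t : I.1 => j t) = (fun t : I.1 => j' t) then 1 else 0 with hL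
  change ∑ k, ∑ j, ∑ j', T k j * T k j' * L j j' = ∑ s : (∀ t, Fin (stackDim N d n t)),
    ∑ s' : (∀ t, Fin (stackDim N d n t)), T (stackEquiv s).1 (stackEquiv s).2 *
      T (stackEquiv s').1 (stackEquiv s').2 *
      if (stackEquiv s).1 = (stackEquiv s').1 then L (stackEquiv s).2 (stackEquiv s').2 else 0
  have h1 : ∀ q : Fin n × (Fin N → Fin d), (∑ s' : (∀ t, Fin (stackDim N d n t)), T q.1 q.2 *
      T (stackEquiv s').1 (stackEquiv s').2 *
      if q.1 = (stackEquiv s').1 then L q.2 (stackEquiv s').2 else 0) =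
      ∑ j', T q.1 q.2 * T q.1 j' * L q.2 j' := fun q => by
    rw [stackEquiv.sum_comp fun q' : Fin n × (Fin N → Fin d) => T q.1 q.2 * T q'.1 q'.2 *
      if q.1 = q'.1 then L q.2 q'.2 else 0, Fintype.sum_prod_type, Finset.sum_comm]
    refine Finset.sum_congr rfl fun j' _ => ?_
    simp
  simp_rw [h1]
  rw [stackEquiv.sum_comp fun q : Fin n × (Fin N → Fin d) =>
    ∑ j', T q.1 q.2 * T q.1 j' * L q.2 j', Fintype.sum_prod_type]

theorem regroup_sum_smul (c : Fin n → ℝ) (T : Fin n → Tensor (fun _ : Fin N => Fin d)) :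
    regroup P (∑ k, c k • T k) = ∑ k, c k • regroup P (T k) := by
  ext j
  simp [regroup, Finset.sum_apply]

end Tensor

/-! ### The moment inequality -/

theorem corollary3 :
    ∃ C : ℕ → ℝ, ∀ (N d n : ℕ), 1 ≤ N →
      ∀ (T : Fin n → Tensor (fun _ : Fin N => Fin d))
        (P : Finpartition (Finset.univ : Finset (Fin N)))
        {Ω : Type*} [MeasurableSpace Ω] (μ : Measure Ω) [IsProbabilityMeasure μ]
        (ξ : Fin n → Ω → ℝ),
        iIndepFun ξ μ → (∀ k, ∫ ω, ξ k ω ∂μ = 0) → (∀ k, HasSubgaussianMGF (ξ k) 1 μ) →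
      ∀ p : ℝ, 2 ≤ p →
        Integrable (fun ω => (Tensor.regroup P (∑ k, ξ k ω • T k)).injNorm ^ p) μ ∧
        (∫ ω, (Tensor.regroup P (∑ k, ξ k ω • T k)).injNorm ^ p ∂μ) ^ (1 / p) ≤
          C P.parts.card *
            ∑ Q : Finpartition (Finset.univ : Finset (Fin (N + 1))),
              p ^ (((Q.parts.card : ℝ) - (P.parts.card : ℝ)) / 2) *
                (Tensor.regroup Q (Tensor.stack T)).injNorm := by
  -- The exponential comes from the moment bound. The factor 2^m counts the sets J of blocks, the
  -- term of each being bounded crudely by the whole sum over Q.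
  refine ⟨fun m => Real.exp ((m + 1) / 2) * 2 ^ m, ?_⟩
  intro N d n hN T P Ω _ μ _ ξ hind _ hξ p hp
  have hp0 : 0 < p := by linarith
  have hne : ∀ {M : ℕ}, 0 < M → ∀ Q : Finpartition (Finset.univ : Finset (Fin M)),
      Nonempty Q.parts := fun hM Q =>
    ⟨⟨Q.part ⟨0, hM⟩, Q.part_mem.2 (Finset.mem_univ _)⟩⟩
  have := hne hN P
  have hQ : ∀ Q : Finpartition (Finset.univ : Finset (Fin (N + 1))),
      0 ≤ (Tensor.regroup Q (Tensor.stack T)).injNorm := fun Q =>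
    have := hne N.succ_pos Q
    Tensor.injNorm_nonneg _
  simp_rw [Tensor.regroup_sum_smul]
  obtain ⟨h1, h2⟩ := Tensor.moment_injNorm_le hind hξ (fun k => Tensor.regroup P (T k))
    (M := fun J => (Tensor.regroup (Tensor.stackPartition P J) (Tensor.stack T)).injNorm)
    (fun J => hQ _) (fun J x hx => Tensor.sum_partialSq_regroup_le P J x T hx) hp0
  refine ⟨h1, h2.trans ?_⟩
  rw [Fintype.card_coe, mul_assoc]
  refine mul_le_mul_of_nonneg_left ?_ (Real.exp_pos _).le
  set R := ∑ Q : Finpartition (Finset.univ : Finset (Fin (N + 1))),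
    p ^ (((Q.parts.card : ℝ) - (P.parts.card : ℝ)) / 2) *
      (Tensor.regroup Q (Tensor.stack T)).injNorm with hR
  have hJ : ∀ J : Finset P.parts, p ^ ((J.card + 1 - P.parts.card : ℝ) / 2) *
      (Tensor.regroup (Tensor.stackPartition P J) (Tensor.stack T)).injNorm ≤ R := fun J => by
    refine le_trans (le_of_eq ?_) (Finset.single_le_sum
      (f := fun Q : Finpartition (Finset.univ : Finset (Fin (N + 1))) =>
        p ^ (((Q.parts.card : ℝ) - (P.parts.card : ℝ)) / 2) *
        (Tensor.regroup Q (Tensor.stack T)).injNorm)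
      (fun Q _ => mul_nonneg (Real.rpow_nonneg hp0.le _) (hQ Q))
      (Finset.mem_univ (Tensor.stackPartition P J)))
    rw [Tensor.card_stackPartition]
    push_cast
    rfl
  refine (Finset.sum_le_sum fun J _ => hJ J).trans_eq ?_
  simp [Finset.card_univ, Fintype.card_finset]
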